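/- Let \(\ln\) denote the natural logarithm and \(\log\) the logarithm to base \(2\). For \(S\subseteq\mathbb F_2^U\) and a linear map \(H:\mathbb F_2^U\to\mathbb F_2^\ell\), let \[ \mathsf M(S,H):=\max_{y\in\mathbb F_2^\ell}\bigl|H^{-1}(y)\cap S\bigr| \] be the maximum load. There exist absolute constants \(C_0>0\), \(D_0>0\) and \(\ell_0\in\mathbb N\) such that the following holds. Let \(\ell\ge\ell_0\) and \(U\ge\ell\) be natural numbers, let \(S\subseteq\mathbb F_2^U\) have size \(2^\ell\), and let \(H:\mathbb F_2^U\to\mathbb F_2^\ell\) be a uniformly random surjective linear map. Then, for every real \(R>1\) satisfying \(R\,\ell^{1-1/R}\ge D_0\ln\ell\), \[ \Pr_H\left[\mathsf M(S,H)\ge R\,\frac{\ell}{\log\ell}\right]\le C_0\,\frac{(\ln\ell)^2}{R^2\,\ell^{2-2/R}}. \] -/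

import Mathlib

open MeasureTheory ProbabilityTheory

namespace LinearHashing

/-- The vector space `𝔽₂ᵈ`. -/
abbrev F2Vec (d : ℕ) : Type := Fin d → ZMod 2

/-- Linear maps `𝔽₂ᵁ → 𝔽₂^ℓ`. -/
abbrev HashMap (U ℓ : ℕ) : Type := F2Vec U →ₗ[ZMod 2] F2Vec ℓ

/-- The load of the bin `y`: the number of keys in `S` that are hashed to `y`. -/
def load {U ℓ : ℕ} (S : Finset (F2Vec U)) (H : HashMap U ℓ) (y : F2Vec ℓ) : ℕ :=
  (S.filter (fun x => H x = y)).card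

/-- The maximum load over all bins `y`. -/
def maxLoad {U ℓ : ℕ} (S : Finset (F2Vec U)) (H : HashMap U ℓ) : ℕ :=
  Finset.univ.sup (load S H)

/-- Every event about a linear map between these finite spaces is measurable. -/
instance hashMapMeasurableSpace (U ℓ : ℕ) : MeasurableSpace (HashMap U ℓ) := ⊤

/-- The law of a uniformly random surjective linear map `𝔽₂ᵁ → 𝔽₂^ℓ`. -/
noncomputable def uniformSurjective (U ℓ : ℕ) : Measure (HashMap U ℓ) :=
  uniformOn {H : HashMap U ℓ | Function.Surjective H}

end LinearHashing

namespace LinearHashing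

open Finset BigOperators

/-! For a surjection `H` onto `𝔽₂ʲ`, let `Z_j` be the average of `c ^ load` over the bins, and let
`x_j` be `c - 1` times the mean load. Then `Z_j ≥ 1 + x_j`, with equality when `H` is injective, in
particular at `j = U`. A uniform surjection onto `𝔽₂ʲ` is one onto `𝔽₂ʲ⁺¹` followed by quotienting
by a random nonzero vector. Loads of merged bins add, so by Cauchy–Schwarz the conditional mean of
`Z_j` is at most `Z_{j+1}²`. Jensen gives `E φ(Z_j) ≤ E φ(Z_{j+1}²)` for concave increasing `φ`
(`expect_concave_loadMoment_le`).

Taking `φ = log` up to level `U` gives `E log Z_j ≤ x_j`. Markov's inequality would then only give a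
tail of order `x/r`. For a quadratic tail, take a truncated multiple of `(log t + 2)³` minus its
value at `1 + x_j` (`expect_min_logExcess_succ`). Per level the multiplier grows by 8 and `x²`
shrinks by 4, so the errors double and the last one dominates. After about `log₂ r` levels, the
logarithmic bound controls what remains (`expect_log_loadMoment_tail`).

Finally, one heavy bin makes `log Z_ℓ` large (`mul_log_sub_le_log_loadMoment`), and `c = e·ℓ^(1/R)`
gives the stated rate. -/

/-- If the fibres of `p : α → β` are permuted transitively by bijections of `α`, then `p` pushes the
uniform distribution forward to the uniform distribution. -/
lemma expect_comp_of_transitive {α β : Type*} [Fintype α] [Fintype β] [Nonempty α]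
    (p : α → β) (h : ∀ b b', ∃ e : α ≃ α, ∀ a, p (e a) = b' ↔ p a = b) (φ : β → ℝ) :
    𝔼 a, φ (p a) = 𝔼 b, φ b := by
  classical
  obtain ⟨a₀⟩ := ‹Nonempty α›
  set K : ℕ := #{a | p a = p a₀} with hK
  have hfib : ∀ b, #{a | p a = b} = K := by
    intro b
    obtain ⟨e, he⟩ := h b (p a₀)
    refine Finset.card_bij (fun a _ => e a) ?_ ?_ ?_
    · intro a ha
      simpa [he] using ha
    · intro a _ a' _ haa
      exact e.injective haa
    · intro a ha
      refine ⟨e.symm a, ?_, by simp⟩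
      have := (he (e.symm a)).1 (by simpa using ha)
      simpa using this
  have hsum : ∀ ψ : β → ℝ, ∑ a, ψ (p a) = K * ∑ b, ψ b := by
    intro ψ
    rw [← Finset.sum_fiberwise univ p, Finset.mul_sum]
    refine Finset.sum_congr rfl fun b _ => ?_
    rw [Finset.sum_congr rfl (g := fun _ => ψ b) (by intro a ha; simp at ha; rw [ha])]
    simp [hfib]
  have hcard : (Fintype.card α : ℝ) = K * Fintype.card β := by
    simpa using hsum fun _ => 1
  have hK0 : (K : ℝ) ≠ 0 := by
    intro h0
    have : (Fintype.card α : ℝ) ≠ 0 := by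
      have : Nonempty α := ⟨a₀⟩
      exact_mod_cast Fintype.card_ne_zero
    rw [hcard, h0, zero_mul] at this
    exact this rfl
  rw [Fintype.expect_eq_sum_div_card, Fintype.expect_eq_sum_div_card, hsum, hcard,
    mul_div_mul_left _ _ hK0]

/-- Complements of the kernels split `V` as `W × ker f` and as `W × ker g`; the kernels have equal
dimension, so the two splittings can be matched over `W`. -/
lemma exists_linearEquiv_comp_eq {K V W : Type*} [Field K] [AddCommGroup V] [Module K V]
    [AddCommGroup W] [Module K W] [FiniteDimensional K V] (f g : V →ₗ[K] W)
    (hf : Function.Surjective f) (hg : Function.Surjective g) :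
    ∃ e : V ≃ₗ[K] V, ∀ x, f (e x) = g x := by
  have hW : FiniteDimensional K W := Module.Finite.of_surjective f hf
  obtain ⟨p, hp⟩ := (LinearMap.ker f).exists_isCompl
  obtain ⟨q, hq⟩ := (LinearMap.ker g).exists_isCompl
  have hf' := LinearMap.finrank_range_add_finrank_ker f
  have hg' := LinearMap.finrank_range_add_finrank_ker g
  rw [LinearMap.range_eq_top.2 hf, finrank_top] at hf'
  rw [LinearMap.range_eq_top.2 hg, finrank_top] at hg'
  let k : LinearMap.ker g ≃ₗ[K] LinearMap.ker f := LinearEquiv.ofFinrankEq _ _ (by omega)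
  let ef := (LinearMap.ker f).projectionOnto p hp
  let eg := (LinearMap.ker g).projectionOnto q hq
  let Ef := f.equivProdOfSurjectiveOfIsCompl ef (LinearMap.range_eq_top.2 hf)
    (Submodule.range_projectionOnto hp) (by rw [Submodule.ker_projectionOnto]; exact hp)
  let Eg := g.equivProdOfSurjectiveOfIsCompl eg (LinearMap.range_eq_top.2 hg)
    (Submodule.range_projectionOnto hq) (by rw [Submodule.ker_projectionOnto]; exact hq)
  refine ⟨Eg ≪≫ₗ ((LinearEquiv.refl K W).prodCongr k) ≪≫ₗ Ef.symm, fun x => ?_⟩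
  have : Ef (Ef.symm (((LinearEquiv.refl K W).prodCongr k) (Eg x))) =
    ((LinearEquiv.refl K W).prodCongr k) (Eg x) := by simp
  exact congrArg Prod.fst this

lemma exists_linearEquiv_apply_eq {K V : Type*} [Field K] [AddCommGroup V] [Module K V]
    [FiniteDimensional K V] {v w : V} (hv : v ≠ 0) (hw : w ≠ 0) :
    ∃ e : V ≃ₗ[K] V, e v = w := by
  obtain ⟨e, he⟩ := Submodule.exists_linearEquiv_restrict_eq
    ((LinearEquiv.toSpanNonzeroSingleton K V v hv).symm ≪≫ₗ
      LinearEquiv.toSpanNonzeroSingleton K V w hw)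
  refine ⟨e, ?_⟩
  have h := he ⟨v, Submodule.mem_span_singleton_self v⟩
  rw [← h, LinearEquiv.trans_apply,
    show (⟨v, Submodule.mem_span_singleton_self v⟩ : Submodule.span K {v}) =
      LinearEquiv.toSpanNonzeroSingleton K V v hv 1 by ext1; simp, LinearEquiv.symm_apply_apply]
  simp

/-! ### Uniformly random surjections and automorphisms -/

instance (U ℓ : ℕ) : Finite (HashMap U ℓ) := DFunLike.finite _

instance (n : ℕ) : Finite (F2Vec n ≃ₗ[ZMod 2] F2Vec n) := DFunLike.finite _

noncomputable instance (n : ℕ) : Fintype (F2Vec n ≃ₗ[ZMod 2] F2Vec n) := Fintype.ofFinite _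

/-- Surjective linear maps `𝔽₂ᵁ → 𝔽₂^ℓ`. -/
abbrev SurjHash (U ℓ : ℕ) : Type := {H : HashMap U ℓ // Function.Surjective H}

noncomputable instance (U ℓ : ℕ) : Fintype (SurjHash U ℓ) := Fintype.ofFinite _

lemma nonempty_surjHash {U ℓ : ℕ} (h : ℓ ≤ U) : Nonempty (SurjHash U ℓ) :=
  ⟨⟨LinearMap.funLeft _ _ (Fin.castLE h),
    LinearMap.funLeft_surjective_of_injective _ _ _ (Fin.castLE_injective h)⟩⟩

/-- Composition of surjective maps. -/
def SurjHash.comp {U m n : ℕ} (Q : SurjHash m n) (H : SurjHash U m) : SurjHash U n :=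
  ⟨Q.1 ∘ₗ H.1, Q.2.comp H.2⟩

lemma expect_surjHash_comp {U m n : ℕ} (h : m ≤ U) (Q : SurjHash m n) (φ : SurjHash U n → ℝ) :
    𝔼 H : SurjHash U m, φ (Q.comp H) = 𝔼 H, φ H := by
  have := nonempty_surjHash h
  refine expect_comp_of_transitive (fun H => Q.comp H) (fun b b' => ?_) φ
  obtain ⟨e, he⟩ := exists_linearEquiv_comp_eq b.1 b'.1 b.2 b'.2
  have key : b'.1 = b.1 ∘ₗ e.toLinearMap := LinearMap.ext fun x => by simp [he]
  refine ⟨⟨fun H => ⟨H.1 ∘ₗ e.toLinearMap, H.2.comp e.surjective⟩,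
    fun H => ⟨H.1 ∘ₗ e.symm.toLinearMap, H.2.comp e.symm.surjective⟩, ?_, ?_⟩, ?_⟩
  · exact fun H => Subtype.ext <| LinearMap.ext fun x => by simp
  · exact fun H => Subtype.ext <| LinearMap.ext fun x => by simp
  · intro H
    simp only [SurjHash.comp, Equiv.coe_fn_mk, Subtype.ext_iff, key]
    rw [← LinearMap.comp_assoc]
    constructor
    · intro hh
      refine LinearMap.ext fun x => ?_
      simpa using congrArg (fun f => f (e.symm x)) hh
    · intro hh
      rw [hh]

lemma expect_surjHash_linearEquiv {U m : ℕ} (k : F2Vec m ≃ₗ[ZMod 2] F2Vec m)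
    (φ : SurjHash U m → ℝ) :
    𝔼 H : SurjHash U m, φ (SurjHash.comp ⟨k.toLinearMap, k.surjective⟩ H) = 𝔼 H, φ H := by
  refine Fintype.expect_equiv
    ⟨fun H => SurjHash.comp ⟨k.toLinearMap, k.surjective⟩ H,
      fun H => SurjHash.comp ⟨k.symm.toLinearMap, k.symm.surjective⟩ H, ?_, ?_⟩ _ _ fun _ => rfl
  · exact fun H => Subtype.ext <| LinearMap.ext fun x => by simp [SurjHash.comp]
  · exact fun H => Subtype.ext <| LinearMap.ext fun x => by simp [SurjHash.comp]

lemma expect_linearEquiv_symm_apply {m : ℕ} {v : F2Vec m} (hv : v ≠ 0) (ψ : F2Vec m → ℝ) :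
    𝔼 k : F2Vec m ≃ₗ[ZMod 2] F2Vec m, ψ (k.symm v) = 𝔼 w : {w : F2Vec m // w ≠ 0}, ψ w := by
  have : Nonempty (F2Vec m ≃ₗ[ZMod 2] F2Vec m) := ⟨LinearEquiv.refl _ _⟩
  refine expect_comp_of_transitive
    (fun k : F2Vec m ≃ₗ[ZMod 2] F2Vec m => (⟨k.symm v, by simpa using hv⟩ : {w : F2Vec m // w ≠ 0}))
    (fun b b' => ?_) fun w => ψ w
  obtain ⟨e, he⟩ := exists_linearEquiv_apply_eq (K := ZMod 2) b.2 b'.2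
  refine ⟨⟨fun k => e.symm ≪≫ₗ k, fun k => e ≪≫ₗ k, ?_, ?_⟩, ?_⟩
  · intro k; ext1 x; simp
  · intro k; ext1 x; simp
  · intro k
    simp only [Equiv.coe_fn_mk, Subtype.ext_iff, LinearEquiv.trans_symm, LinearEquiv.trans_apply,
      LinearEquiv.symm_symm, ← he]
    exact e.injective.eq_iff

/-! ### The load moment under a one-dimensional quotient -/

/-- The exponential moment of the load of a uniformly random bin. -/
noncomputable def loadMoment {U j : ℕ} (c : ℝ) (S : Finset (F2Vec U)) (H : HashMap U j) : ℝ :=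
  𝔼 y, c ^ load S H y

lemma expect_comp_surjHash {m n : ℕ} (Q : SurjHash m n) (ψ : F2Vec n → ℝ) :
    𝔼 y, ψ (Q.1 y) = 𝔼 z, ψ z := by
  refine expect_comp_of_transitive (fun y => Q.1 y) (fun b b' => ?_) ψ
  obtain ⟨d, hd⟩ := Q.2 (b' - b)
  refine ⟨Equiv.addRight d, fun a => ?_⟩
  simp only [Equiv.coe_addRight, map_add, hd]
  rw [← eq_sub_iff_add_eq, sub_sub_cancel]

lemma load_comp {U m n : ℕ} (S : Finset (F2Vec U)) (H : HashMap U m) (Q : HashMap m n)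
    {v : F2Vec m} (hv : v ≠ 0) (hQ : ∀ x, Q x = 0 ↔ x = 0 ∨ x = v) (y : F2Vec m) :
    load S (Q ∘ₗ H) (Q y) = load S H y + load S H (y + v) := by
  classical
  unfold load
  rw [← Finset.card_union_of_disjoint]
  · congr 1
    ext x
    have : Q (H x) = Q y ↔ H x = y ∨ H x = y + v := by
      rw [← sub_eq_zero, ← map_sub, hQ, sub_eq_zero, sub_eq_iff_eq_add, add_comm v]
    simp only [mem_filter, mem_union, LinearMap.comp_apply, this]
    tauto
  · rw [Finset.disjoint_filter]
    intro x _ h1 h2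
    rw [h1] at h2
    exact hv (by simpa using h2)

/-- Over all `w` the correlations sum to `(∑ F)²`. The omitted term `w = 0` is `∑ F²`, which
Cauchy–Schwarz shows is at least the average term. -/
lemma expect_ne_zero_mul_le {m : ℕ} (hm : m ≠ 0) (F : F2Vec m → ℝ) :
    𝔼 w : {w : F2Vec m // w ≠ 0}, 𝔼 y, F y * F (y + w) ≤ (𝔼 y, F y) ^ 2 := by
  have hN : (2 : ℝ) ≤ Fintype.card (F2Vec m) := by
    have : 2 ≤ 2 ^ m := by simpa using Nat.pow_le_pow_right (n := 2) (by norm_num) (Nat.one_le_iff_ne_zero.2 hm)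
    simpa using (by exact_mod_cast this : (2 : ℝ) ≤ 2 ^ m)
  have hcard : (Fintype.card {w : F2Vec m // w ≠ 0} : ℝ) = Fintype.card (F2Vec m) - 1 := by
    rw [Fintype.card_subtype_compl, Nat.cast_sub (Fintype.card_subtype_le _)]
    simp
  have hsum : ∑ w : {w : F2Vec m // w ≠ 0}, ∑ y, F y * F (y + w) =
      (∑ y, F y) ^ 2 - ∑ y, F y ^ 2 := by
    have h1 : ∑ w : F2Vec m, ∑ y, F y * F (y + w) = (∑ y, F y) ^ 2 := by
      rw [Finset.sum_comm, sq, Finset.sum_mul]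
      refine Finset.sum_congr rfl fun y _ => ?_
      rw [← Finset.mul_sum]
      congr 1
      exact Fintype.sum_equiv (Equiv.addLeft y) _ _ fun _ => rfl
    have h2 := Finset.sum_erase_add univ (fun w : F2Vec m => ∑ y, F y * F (y + w)) (mem_univ 0)
    have h3 : ∑ w : {w : F2Vec m // w ≠ 0}, ∑ y, F y * F (y + w) =
        ∑ w ∈ univ.erase (0 : F2Vec m), ∑ y, F y * F (y + w) :=
      (Finset.sum_subtype (univ.erase (0 : F2Vec m)) (p := fun w => w ≠ 0)
        (fun w => by simp)
        fun w => ∑ y, F y * F (y + w)).symm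
    rw [h3, ← h1, ← h2]
    simp [sq]
  have hcs : (∑ y, F y) ^ 2 ≤ Fintype.card (F2Vec m) * ∑ y, F y ^ 2 := by
    simpa using sq_sum_le_card_mul_sum_sq (s := univ) (f := F)
  simp only [Fintype.expect_eq_sum_div_card]
  rw [← Finset.sum_div, hsum, hcard]
  set N : ℝ := (Fintype.card (F2Vec m) : ℝ)
  have hN0 : 0 < N := by linarith
  rw [div_pow, div_div, div_le_div_iff₀ (mul_pos hN0 (by linarith)) (by positivity)]
  nlinarith [mul_le_mul_of_nonneg_left hcs hN0.le]

/-- Forgetting the first coordinate. -/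
def dropFirst (n : ℕ) : SurjHash (n + 1) n :=
  ⟨LinearMap.funLeft _ _ Fin.succ,
    LinearMap.funLeft_surjective_of_injective _ _ _ (Fin.succ_injective n)⟩

lemma dropFirst_eq_zero_iff {n : ℕ} (x : F2Vec (n + 1)) :
    (dropFirst n).1 x = 0 ↔ x = 0 ∨ x = Pi.single 0 1 := by
  have hx : (dropFirst n).1 x = 0 ↔ ∀ i : Fin n, x i.succ = 0 := by
    rw [funext_iff]; rfl
  rw [hx]
  constructor
  · intro h
    have h2 : ∀ a : ZMod 2, a = 0 ∨ a = 1 := by decide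
    refine (h2 (x 0)).imp (fun h0 => ?_) (fun h0 => ?_)
    · ext i; refine Fin.cases ?_ (fun i => ?_) i <;> simp [h0, h]
    · ext i; refine Fin.cases ?_ (fun i => ?_) i <;> simp [h0, h]
  · rintro (h | h) i <;> simp [h]

lemma sum_load {U j : ℕ} (S : Finset (F2Vec U)) (H : HashMap U j) :
    ∑ y, (load S H y : ℝ) = S.card := by
  rw [← Nat.cast_sum]
  congr 1
  exact (Finset.card_eq_sum_card_fiberwise (f := H) (t := univ) (by simp)).symm

lemma one_add_le_loadMoment {U j : ℕ} {c : ℝ} (hc : 1 ≤ c) (S : Finset (F2Vec U)) (H : HashMap U j) :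
    1 + (c - 1) * (S.card / 2 ^ j) ≤ loadMoment c S H := by
  have h : ∀ y, 1 + (load S H y : ℝ) * (c - 1) ≤ c ^ load S H y := fun y => by
    simpa using one_add_mul_le_pow (a := c - 1) (by linarith) (load S H y)
  calc 1 + (c - 1) * ((S.card : ℝ) / 2 ^ j) = 𝔼 y, (1 + (load S H y : ℝ) * (c - 1)) := by
        rw [Finset.expect_add_distrib, ← Finset.expect_mul, Fintype.expect_const,
          Fintype.expect_eq_sum_div_card, sum_load]
        simp [mul_comm]
    _ ≤ _ := Finset.expect_le_expect fun y _ => h y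

lemma loadMoment_of_injective {U j : ℕ} (c : ℝ) (S : Finset (F2Vec U)) (H : HashMap U j)
    (hH : Function.Injective H) : loadMoment c S H = 1 + (c - 1) * (S.card / 2 ^ j) := by
  have h : ∀ y, c ^ load S H y = 1 + (load S H y : ℝ) * (c - 1) := fun y => by
    have : load S H y ≤ 1 := Finset.card_le_one.2 fun a ha b hb =>
      hH (((mem_filter.1 ha).2).trans (mem_filter.1 hb).2.symm)
    interval_cases load S H y <;> simp
  rw [loadMoment, Finset.expect_congr rfl fun y _ => h y, Finset.expect_add_distrib,
    ← Finset.expect_mul, Fintype.expect_const, Fintype.expect_eq_sum_div_card, sum_load]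
  simp [mul_comm]

/-- The composite with `k` merges the bins `y` and `y + k⁻¹e₀`, and `k⁻¹e₀` is uniform among nonzero
vectors. -/
lemma expect_loadMoment_comp_le {U n : ℕ} (c : ℝ) (S : Finset (F2Vec U)) (H : HashMap U (n + 1)) :
    𝔼 k : F2Vec (n + 1) ≃ₗ[ZMod 2] F2Vec (n + 1),
      loadMoment c S ((dropFirst n).1 ∘ₗ (k.toLinearMap ∘ₗ H)) ≤ loadMoment c S H ^ 2 := by
  have hv : (Pi.single 0 1 : F2Vec (n + 1)) ≠ 0 := by simp
  have h : ∀ k : F2Vec (n + 1) ≃ₗ[ZMod 2] F2Vec (n + 1),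
      loadMoment c S ((dropFirst n).1 ∘ₗ (k.toLinearMap ∘ₗ H)) =
      𝔼 y, c ^ load S H y * c ^ load S H (y + k.symm (Pi.single 0 1)) := by
    intro k
    let Q : SurjHash (n + 1) n := (dropFirst n).comp ⟨k.toLinearMap, k.surjective⟩
    rw [loadMoment, ← LinearMap.comp_assoc]
    change 𝔼 y, c ^ load S (Q.1 ∘ₗ H) y = _
    rw [← expect_comp_surjHash Q]
    refine Finset.expect_congr rfl fun y _ => ?_
    rw [load_comp S H Q.1 (v := k.symm (Pi.single 0 1)) (by simp) (fun x => ?_) y, pow_add]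
    change (dropFirst n).1 (k x) = 0 ↔ _
    rw [dropFirst_eq_zero_iff, LinearEquiv.map_eq_zero_iff, LinearEquiv.eq_symm_apply]
  rw [Finset.expect_congr rfl fun k _ => h k,
    expect_linearEquiv_symm_apply hv (fun w => 𝔼 y, c ^ load S H y * c ^ load S H (y + w))]
  exact expect_ne_zero_mul_le (Nat.succ_ne_zero n) _

lemma concaveOn_expect_le {ι : Type*} [Fintype ι] [Nonempty ι] {s : Set ℝ} {φ : ℝ → ℝ}
    (hφ : ConcaveOn ℝ s φ) {X : ι → ℝ} (hX : ∀ i, X i ∈ s) :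
    𝔼 i, φ (X i) ≤ φ (𝔼 i, X i) := by
  have := hφ.le_map_sum (t := univ) (w := fun _ : ι => (Fintype.card ι : ℝ)⁻¹) (p := X)
    (fun _ _ => by positivity) (by simp) (fun i _ => hX i)
  simpa [Fintype.expect_eq_sum_div_card, ← Finset.mul_sum, div_eq_inv_mul] using this

/-- Concave functions of the load moment: one random linear functional fewer squares the moment. -/
lemma expect_concave_loadMoment_le {U n : ℕ} (hn : n + 1 ≤ U) {c : ℝ} (hc : 1 ≤ c)
    (S : Finset (F2Vec U)) {φ : ℝ → ℝ} (hφ : ConcaveOn ℝ (Set.Ici 1) φ)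
    (hmono : MonotoneOn φ (Set.Ici 1)) :
    𝔼 H : SurjHash U n, φ (loadMoment c S H.1) ≤
      𝔼 H : SurjHash U (n + 1), φ (loadMoment c S H.1 ^ 2) := by
  have hone : ∀ {j : ℕ} (H : HashMap U j), 1 ≤ loadMoment c S H := fun {j} H => by
    refine le_trans ?_ (one_add_le_loadMoment hc S H)
    have : 0 ≤ (c - 1) * ((S.card : ℝ) / 2 ^ j) := mul_nonneg (by linarith) (by positivity)
    linarith
  have : Nonempty (F2Vec (n + 1) ≃ₗ[ZMod 2] F2Vec (n + 1)) := ⟨LinearEquiv.refl _ _⟩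
  have hne := nonempty_surjHash hn
  calc 𝔼 H : SurjHash U n, φ (loadMoment c S H.1)
      = 𝔼 H : SurjHash U (n + 1), φ (loadMoment c S ((dropFirst n).comp H).1) :=
        (expect_surjHash_comp hn (dropFirst n) fun H => φ (loadMoment c S H.1)).symm
    -- The law of `H` is invariant under each automorphism `k`, so averaging over `k` costs nothing
    -- and randomizes the quotient for fixed `H`.
    _ = 𝔼 k : F2Vec (n + 1) ≃ₗ[ZMod 2] F2Vec (n + 1), 𝔼 H : SurjHash U (n + 1),
          φ (loadMoment c S ((dropFirst n).comp
            (SurjHash.comp ⟨k.toLinearMap, k.surjective⟩ H)).1) := by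
        rw [← Fintype.expect_const (ι := F2Vec (n + 1) ≃ₗ[ZMod 2] F2Vec (n + 1))
          (𝔼 H : SurjHash U (n + 1), φ (loadMoment c S ((dropFirst n).comp H).1))]
        exact Finset.expect_congr rfl fun k _ => (expect_surjHash_linearEquiv k
          fun H => φ (loadMoment c S ((dropFirst n).comp H).1)).symm
    _ = 𝔼 H : SurjHash U (n + 1), 𝔼 k : F2Vec (n + 1) ≃ₗ[ZMod 2] F2Vec (n + 1),
          φ (loadMoment c S ((dropFirst n).1 ∘ₗ (k.toLinearMap ∘ₗ H.1))) :=
        Finset.expect_comm _ _ _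
    _ ≤ _ := Finset.expect_le_expect fun H _ =>
        (concaveOn_expect_le hφ fun k => hone _).trans
          (hmono (Finset.le_expect univ_nonempty fun k _ => hone _)
            (one_le_pow₀ (hone _)) (expect_loadMoment_comp_le c S H.1))

/-! ### Inequalities for the cubed logarithm -/

lemma concaveOn_log_add_two_pow_three :
    ConcaveOn ℝ (Set.Ici 1) fun t : ℝ => (Real.log t + 2) ^ 3 := by
  have hd : ∀ t : ℝ, 0 < t → HasDerivAt (fun t : ℝ => (Real.log t + 2) ^ 3)
      (3 * (Real.log t + 2) ^ 2 / t) t := fun t ht => by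
    refine (((Real.hasDerivAt_log ht.ne').add_const 2).pow 3).congr_deriv ?_
    norm_num [div_eq_mul_inv]
  -- The shift 2 cancels the constant term, leaving the factor `-log t`, which is nonpositive
  -- exactly on `t ≥ 1`.
  have hd2 : ∀ t : ℝ, 0 < t → HasDerivAt (fun t : ℝ => 3 * (Real.log t + 2) ^ 2 / t)
      (-(3 * Real.log t * (Real.log t + 2)) / t ^ 2) t := fun t ht => by
    refine (((((Real.hasDerivAt_log ht.ne').add_const 2).pow 2).const_mul 3).div
      (hasDerivAt_id t) ht.ne').congr_deriv ?_
    simp only [id, Pi.pow_apply, Nat.cast_ofNat, Nat.add_one_sub_one, pow_one]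
    field_simp
    ring
  have hev : ∀ t : ℝ, 0 < t → deriv (fun t : ℝ => (Real.log t + 2) ^ 3) =ᶠ[nhds t]
      fun t : ℝ => 3 * (Real.log t + 2) ^ 2 / t := fun t ht => by
    filter_upwards [lt_mem_nhds ht] with s hs using (hd s hs).deriv
  refine concaveOn_of_deriv2_nonpos (convex_Ici 1) ?_ ?_ ?_ ?_
  · exact fun t ht => (hd t (lt_of_lt_of_le one_pos ht)).continuousAt.continuousWithinAt
  · rw [interior_Ici]
    exact fun t ht => (hd t (one_pos.trans ht)).differentiableAt.differentiableWithinAt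
  · rw [interior_Ici]
    exact fun t ht => ((hev t (one_pos.trans ht)).differentiableAt_iff.2
      (hd2 t (one_pos.trans ht)).differentiableAt).differentiableWithinAt
  · rw [interior_Ici]
    intro t ht
    have h0 : (0 : ℝ) < t := one_pos.trans ht
    have hlog : 0 < Real.log t := Real.log_pos ht
    simp only [Function.iterate_succ, Function.iterate_zero, Function.comp_apply, id]
    rw [(hev t h0).deriv_eq, (hd2 t h0).deriv]
    exact div_nonpos_of_nonpos_of_nonneg (neg_nonpos.2 (by positivity)) (by positivity)

lemma one_add_log_sq_le {x : ℝ} (hx : 0 ≤ x) : (1 + Real.log (1 + x)) ^ 2 ≤ 4 * (1 + x) := by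
  have hz : 1 ≤ √(1 + x) := Real.one_le_sqrt.2 (by linarith)
  have hsq : √(1 + x) ^ 2 = 1 + x := Real.sq_sqrt (by linarith)
  have h1 : Real.log (1 + x) ≤ 2 * (√(1 + x) - 1) := by
    rw [← hsq, Real.log_pow]
    have := Real.log_le_sub_one_of_pos (lt_of_lt_of_le one_pos hz)
    simpa [Real.sqrt_sq (zero_le_one.trans hz)] using this
  have h2 : 0 ≤ Real.log (1 + x) := Real.log_nonneg (by linarith)
  nlinarith

lemma cube_log_doubling {x T : ℝ} (hx : 0 ≤ x) (hT : Real.log (1 + x) ≤ T) :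
    (2 * T + 2) ^ 3 - (Real.log (1 + 2 * x) + 2) ^ 3 ≤
      8 * ((T + 2) ^ 3 - (Real.log (1 + x) + 2) ^ 3) + 48 * x ^ 2 := by
  have h0 : 0 ≤ Real.log (1 + x) := Real.log_nonneg (by linarith)
  have h20 : 0 ≤ Real.log (1 + 2 * x) := Real.log_nonneg (by linarith)
  have hsq := one_add_log_sq_le hx
  have hd : 2 * Real.log (1 + x) - Real.log (1 + 2 * x) =
      Real.log ((1 + x) ^ 2 / (1 + 2 * x)) := by
    rw [Real.log_div (by positivity) (by positivity), Real.log_pow]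
    norm_num
  have hd1 : (2 * Real.log (1 + x) - Real.log (1 + 2 * x)) * (1 + 2 * x) ≤ x ^ 2 := by
    rw [hd, ← le_div_iff₀ (by positivity)]
    refine (Real.log_le_sub_one_of_pos (by positivity)).trans (le_of_eq ?_)
    field_simp
    ring
  have hd0 : 0 ≤ 2 * Real.log (1 + x) - Real.log (1 + 2 * x) := by
    rw [hd]
    refine Real.log_nonneg ((one_le_div (by positivity)).2 ?_)
    nlinarith
  set t := Real.log (1 + x)
  set t2 := Real.log (1 + 2 * x)
  -- `8(T + 2)³ - (2T + 2)³` increases for `T ≥ 0`, which reduces the claim to `T = t`.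
  have hmono : 8 * (t + 2) ^ 3 - (2 * t + 2) ^ 3 ≤ 8 * (T + 2) ^ 3 - (2 * T + 2) ^ 3 := by
    nlinarith [mul_nonneg (sub_nonneg.2 hT) h0, mul_nonneg (sub_nonneg.2 hT) (sub_nonneg.2 hT)]
  have hcube : (2 * t + 2) ^ 3 - (t2 + 2) ^ 3 ≤ (2 * t - t2) * (12 * (1 + t) ^ 2) := by
    have : (2 * t + 2) ^ 3 - (t2 + 2) ^ 3 =
        (2 * t - t2) * ((2 * t + 2) ^ 2 + (2 * t + 2) * (t2 + 2) + (t2 + 2) ^ 2) := by ring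
    rw [this]
    refine mul_le_mul_of_nonneg_left ?_ hd0
    nlinarith
  have hfin : (2 * t - t2) * (12 * (1 + t) ^ 2) ≤ 48 * x ^ 2 := by
    calc (2 * t - t2) * (12 * (1 + t) ^ 2) ≤ (2 * t - t2) * (48 * (1 + 2 * x)) :=
          mul_le_mul_of_nonneg_left (by linarith) hd0
      _ ≤ 48 * x ^ 2 := by linarith
  linarith

lemma min_one_cube_sub_le {t T a : ℝ} (ht0 : 0 ≤ t) (ht : t ≤ 1) (hT : t ≤ T) (ha : a ≤ 8) :
    min 1 (a * ((T + 2) ^ 3 - (t + 2) ^ 3)) ≤ 384 * (T - t) := by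
  rcases le_total 1 (T - t) with h | h
  · exact (min_le_left _ _).trans (by linarith)
  · refine (min_le_right _ _).trans ?_
    have h1 : (T + 2) ^ 3 - (t + 2) ^ 3 ≤ (T - t) * 48 := by
      have : (T + 2) ^ 3 - (t + 2) ^ 3 =
        (T - t) * ((T + 2) ^ 2 + (T + 2) * (t + 2) + (t + 2) ^ 2) := by ring
      rw [this]
      refine mul_le_mul_of_nonneg_left ?_ (sub_nonneg.2 hT)
      nlinarith
    have h0 : 0 ≤ (T + 2) ^ 3 - (t + 2) ^ 3 :=
      sub_nonneg.2 (pow_le_pow_left₀ (by linarith) (by linarith) 3)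
    nlinarith

/-! ### Iterating over the dimension of the target -/

/-- The contribution of the expected load to the load moment at base `c`. -/
noncomputable def meanTerm {U : ℕ} (c : ℝ) (S : Finset (F2Vec U)) (j : ℕ) : ℝ :=
  (c - 1) * (S.card / 2 ^ j)

lemma meanTerm_nonneg {U : ℕ} {c : ℝ} (hc : 1 ≤ c) (S : Finset (F2Vec U)) (j : ℕ) :
    0 ≤ meanTerm c S j := mul_nonneg (by linarith) (by positivity)

lemma meanTerm_add {U : ℕ} (c : ℝ) (S : Finset (F2Vec U)) (j n : ℕ) :
    meanTerm c S (j + n) = meanTerm c S j / 2 ^ n := by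
  simp only [meanTerm, pow_add]
  field_simp

lemma meanTerm_succ {U : ℕ} (c : ℝ) (S : Finset (F2Vec U)) (j : ℕ) :
    meanTerm c S j = 2 * meanTerm c S (j + 1) := by
  rw [meanTerm_add]; ring

lemma log_one_add_meanTerm_le {U j : ℕ} {c : ℝ} (hc : 1 ≤ c) (S : Finset (F2Vec U))
    (H : HashMap U j) : Real.log (1 + meanTerm c S j) ≤ Real.log (loadMoment c S H) :=
  Real.log_le_log (by linarith [meanTerm_nonneg hc S j]) (one_add_le_loadMoment hc S H)

lemma loadMoment_of_surjective {U : ℕ} (c : ℝ) (S : Finset (F2Vec U)) (H : SurjHash U U) :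
    loadMoment c S H.1 = 1 + meanTerm c S U :=
  loadMoment_of_injective c S H.1 (LinearMap.injective_iff_surjective.2 H.2)

lemma expect_log_loadMoment_le {U : ℕ} {c : ℝ} (hc : 1 ≤ c) (S : Finset (F2Vec U)) {j : ℕ}
    (hj : j ≤ U) : 𝔼 H : SurjHash U j, Real.log (loadMoment c S H.1) ≤ meanTerm c S j := by
  induction hj using Nat.decreasingInduction with
  | self =>
    have := nonempty_surjHash (le_refl U)
    simp only [loadMoment_of_surjective, Fintype.expect_const]
    have h := meanTerm_nonneg hc S U
    linarith [Real.log_le_sub_one_of_pos (show 0 < 1 + meanTerm c S U by linarith)]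
  | of_succ n hn ih =>
    refine (expect_concave_loadMoment_le hn hc S
      (strictConcaveOn_log_Ioi.concaveOn.subset (Set.Ici_subset_Ioi.2 one_pos)
        (convex_Ici 1))
      (fun x hx y _ hxy => Real.log_le_log (lt_of_lt_of_le one_pos hx) hxy)).trans ?_
    simp only [Real.log_pow, ← Finset.mul_expect]
    rw [meanTerm_succ]
    push_cast
    linarith

/-- Excess of the cubed logarithm of the load moment over its least possible value. -/
noncomputable def logExcess {U j : ℕ} (c : ℝ) (S : Finset (F2Vec U)) (H : HashMap U j) : ℝ :=
  (Real.log (loadMoment c S H) + 2) ^ 3 - (Real.log (1 + meanTerm c S j) + 2) ^ 3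

lemma expect_min_logExcess_succ {U n : ℕ} (hn : n + 1 ≤ U) {c : ℝ} (hc : 1 ≤ c)
    (S : Finset (F2Vec U)) {a : ℝ} (ha : 0 ≤ a) :
    𝔼 H : SurjHash U n, min 1 (a * logExcess c S H.1) ≤
      (𝔼 H : SurjHash U (n + 1), min 1 (8 * a * logExcess c S H.1)) +
        48 * a * meanTerm c S (n + 1) ^ 2 := by
  have hne := nonempty_surjHash hn
  set K := (Real.log (1 + meanTerm c S n) + 2) ^ 3 with hK
  have hconc : ConcaveOn ℝ (Set.Ici 1) fun t : ℝ => min 1 (a * ((Real.log t + 2) ^ 3 - K)) :=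
    (concaveOn_const 1 (convex_Ici 1)).inf
      ((concaveOn_log_add_two_pow_three.sub (convexOn_const K (convex_Ici 1))).smul ha)
  have hmono : MonotoneOn (fun t : ℝ => min 1 (a * ((Real.log t + 2) ^ 3 - K))) (Set.Ici 1) := by
    intro s hs t _ hst
    have h1 : Real.log s ≤ Real.log t := Real.log_le_log (lt_of_lt_of_le one_pos hs) hst
    have h0 : 0 ≤ Real.log s := Real.log_nonneg hs
    exact min_le_min_left _ (mul_le_mul_of_nonneg_left
      (sub_le_sub_right (pow_le_pow_left₀ (by linarith) (by linarith) 3) K) ha)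
  refine (expect_concave_loadMoment_le hn hc S hconc hmono).trans ?_
  rw [← Fintype.expect_const (ι := SurjHash U (n + 1)) (48 * a * meanTerm c S (n + 1) ^ 2),
    ← Finset.expect_add_distrib]
  refine Finset.expect_le_expect fun H _ => ?_
  have hx := meanTerm_nonneg hc S (n + 1)
  have h := cube_log_doubling hx (log_one_add_meanTerm_le hc S H.1)
  rw [← meanTerm_succ, ← hK] at h
  have h' := mul_le_mul_of_nonneg_left h ha
  have h48 : 0 ≤ 48 * a * meanTerm c S (n + 1) ^ 2 := by positivity
  rw [Real.log_pow, ← min_add_add_right]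
  refine le_min ((min_le_left _ _).trans (by linarith)) ((min_le_right _ _).trans ?_)
  rw [logExcess]
  push_cast
  linarith

/-- The `i`-th step (from `i = 0`) has multiplier `8ⁱa` and mean term `x/2^(i+1)`, so its error is
`12ax²·2ⁱ`: a geometric sum. -/
lemma expect_min_logExcess_add {U j : ℕ} {c : ℝ} (hc : 1 ≤ c)
    (S : Finset (F2Vec U)) {a : ℝ} (ha : 0 ≤ a) (n : ℕ) (hn : j + n ≤ U) :
    𝔼 H : SurjHash U j, min 1 (a * logExcess c S H.1) ≤
      (𝔼 H : SurjHash U (j + n), min 1 (8 ^ n * a * logExcess c S H.1)) +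
        12 * a * meanTerm c S j ^ 2 * (2 ^ n - 1) := by
  induction n with
  | zero => simp
  | succ n ih =>
    refine (ih (by omega)).trans ?_
    have h := expect_min_logExcess_succ (n := j + n) hn hc S (a := 8 ^ n * a) (by positivity)
    have e : 48 * (8 ^ n * a) * meanTerm c S (j + n + 1) ^ 2 =
        12 * a * meanTerm c S j ^ 2 * 2 ^ n := by
      rw [add_assoc, meanTerm_add, div_pow, ← pow_mul, mul_comm (n + 1) 2, pow_mul, pow_succ,
        show (8 : ℝ) ^ n = 2 ^ n * 4 ^ n by rw [← mul_pow]; norm_num]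
      norm_num
      field_simp
      ring
    rw [e, ← mul_assoc, ← pow_succ'] at h
    rw [pow_succ (2 : ℝ)]
    change _ ≤ (𝔼 H : SurjHash U (j + n + 1), min 1 (8 ^ (n + 1) * a * logExcess c S H.1)) + _
    linarith

/-! ### The quadratic tail bound -/

open Classical in
/-- The logarithm of the load moment has a quadratic upper tail. -/
lemma expect_log_loadMoment_tail {U j : ℕ} (hj : j ≤ U) {c : ℝ} (hc : 1 ≤ c)
    (S : Finset (F2Vec U)) {r : ℝ} (hr : 1 ≤ r) (hxr : 2 * meanTerm c S j ≤ r) :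
    𝔼 H : SurjHash U j, (if r ≤ Real.log (loadMoment c S H.1) then (1 : ℝ) else 0) ≤
      864 * (meanTerm c S j / r) ^ 2 := by
  have hr0 : 0 < r := by linarith
  have hx := meanTerm_nonneg hc S j
  have ha : 0 ≤ 8 / r ^ 3 := by positivity
  have hD : ∀ {m : ℕ} (H : HashMap U m), 0 ≤ logExcess c S H := fun {m} H => by
    have h1 : 0 ≤ Real.log (1 + meanTerm c S m) :=
      Real.log_nonneg (by linarith [meanTerm_nonneg hc S m])
    exact sub_nonneg.2 (pow_le_pow_left₀ (by linarith)
      (by linarith [log_one_add_meanTerm_le hc S H]) 3)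
  -- On the event the excess is at least `(r + 2)³ - (r/2 + 2)³ ≥ r³/8`, so the multiplier `8/r³`
  -- makes the truncated excess equal to 1.
  have hstart : 𝔼 H : SurjHash U j, (if r ≤ Real.log (loadMoment c S H.1) then (1 : ℝ) else 0) ≤
      𝔼 H : SurjHash U j, min 1 (8 / r ^ 3 * logExcess c S H.1) := by
    refine Finset.expect_le_expect fun H _ => ?_
    split_ifs with hH
    · refine le_min le_rfl ?_
      rw [div_mul_eq_mul_div, one_le_div (by positivity), logExcess]
      have h1 : Real.log (1 + meanTerm c S j) ≤ r / 2 := by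
        linarith [Real.log_le_sub_one_of_pos (show 0 < 1 + meanTerm c S j by linarith)]
      have h0 : 0 ≤ Real.log (1 + meanTerm c S j) := Real.log_nonneg (by linarith)
      have h2 : (r + 2) ^ 3 ≤ (Real.log (loadMoment c S H.1) + 2) ^ 3 :=
        pow_le_pow_left₀ (by linarith) (by linarith) 3
      have h3 : (Real.log (1 + meanTerm c S j) + 2) ^ 3 ≤ (r / 2 + 2) ^ 3 :=
        pow_le_pow_left₀ (by linarith) (by linarith) 3
      nlinarith [pow_pos hr0 2, pow_pos hr0 3]
    · exact le_min zero_le_one (mul_nonneg ha (hD H.1))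
  refine hstart.trans ?_
  have herr : ∀ n : ℕ, (2 : ℝ) ^ n ≤ r →
      12 * (8 / r ^ 3) * meanTerm c S j ^ 2 * (2 ^ n - 1) ≤ 96 * (meanTerm c S j / r) ^ 2 := by
    intro n hn
    calc 12 * (8 / r ^ 3) * meanTerm c S j ^ 2 * (2 ^ n - 1)
        ≤ 12 * (8 / r ^ 3) * meanTerm c S j ^ 2 * r :=
          mul_le_mul_of_nonneg_left (by linarith) (by positivity)
      _ = _ := by field_simp; ring
  have hsq : 0 ≤ (meanTerm c S j / r) ^ 2 := sq_nonneg _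
  obtain ⟨M, rfl⟩ := Nat.exists_eq_add_of_le hj
  -- If level `U` is reached before the scale `r`, the excess there vanishes and only the
  -- accumulated error remains.
  rcases le_total ((2 : ℝ) ^ M) r with hM | hM
  · refine (expect_min_logExcess_add hc S ha M le_rfl).trans ?_
    simp only [logExcess, loadMoment_of_surjective, sub_self, mul_zero]
    have := nonempty_surjHash (le_refl (j + M))
    rw [min_eq_right zero_le_one, Fintype.expect_const]
    linarith [herr M hM]
  -- Otherwise stop at `2ⁿ ≤ r < 2ⁿ⁺¹`: the multiplier is at most 8 and the mean term at most `2x/r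
  -- ≤ 1`. The remainder is at most `384·y²/2 ≤ 768(x/r)²`; with the error 96 this gives 864.
  · obtain ⟨n, hn1, hn2⟩ := exists_nat_pow_near hr (one_lt_two : (1 : ℝ) < 2)
    have hnM : n ≤ M := (pow_le_pow_iff_right₀ (one_lt_two : (1 : ℝ) < 2)).1 (hn1.trans hM)
    have hjn : j + n ≤ j + M := by omega
    have hne := nonempty_surjHash hjn
    refine (expect_min_logExcess_add hc S ha n hjn).trans ?_
    set y := meanTerm c S (j + n) with hy
    have hy0 : 0 ≤ y := meanTerm_nonneg hc S _
    have hyr : y ≤ 2 * (meanTerm c S j / r) := by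
      rw [hy, meanTerm_add, ← mul_div_assoc, div_le_div_iff₀ (by positivity) hr0]
      rw [pow_succ] at hn2
      nlinarith
    have hy1 : y ≤ 1 := by
      refine hyr.trans ?_
      rw [← mul_div_assoc, div_le_one hr0]
      exact hxr
    have hlog0 : 0 ≤ Real.log (1 + y) := Real.log_nonneg (by linarith)
    have hlog1 : Real.log (1 + y) ≤ 1 := by
      linarith [Real.log_le_sub_one_of_pos (show 0 < 1 + y by linarith)]
    have ha8 : 8 ^ n * (8 / r ^ 3) ≤ 8 := by
      have : (8 : ℝ) ^ n ≤ r ^ 3 := by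
        calc (8 : ℝ) ^ n = (2 ^ n) ^ 3 := by rw [← pow_mul, mul_comm, pow_mul]; norm_num
          _ ≤ r ^ 3 := pow_le_pow_left₀ (by positivity) hn1 3
      rw [mul_div_assoc', div_le_iff₀ (by positivity)]
      linarith
    have hmain : 𝔼 H : SurjHash (j + M) (j + n), min 1 (8 ^ n * (8 / r ^ 3) * logExcess c S H.1) ≤
        384 * (y - Real.log (1 + y)) := by
      calc _ ≤ 𝔼 H : SurjHash (j + M) (j + n),
            384 * (Real.log (loadMoment c S H.1) - Real.log (1 + y)) :=
            Finset.expect_le_expect fun H _ =>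
              min_one_cube_sub_le hlog0 hlog1 (log_one_add_meanTerm_le hc S H.1) ha8
        _ = 384 * ((𝔼 H : SurjHash (j + M) (j + n), Real.log (loadMoment c S H.1)) -
              Real.log (1 + y)) := by
            rw [← Finset.mul_expect, Finset.expect_sub_distrib, Fintype.expect_const]
        _ ≤ _ := by linarith [expect_log_loadMoment_le hc S hjn]
    have hquad : y - Real.log (1 + y) ≤ y ^ 2 / 2 := by
      have h := Real.le_log_one_add_of_nonneg hy0
      have : y - 2 * y / (y + 2) ≤ y ^ 2 / 2 := by
        rw [sub_div' (by positivity), div_le_div_iff₀ (by positivity) two_pos]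
        nlinarith [pow_nonneg hy0 3]
      linarith
    have hy2 : y ^ 2 ≤ 4 * (meanTerm c S j / r) ^ 2 := by
      calc y ^ 2 ≤ (2 * (meanTerm c S j / r)) ^ 2 := pow_le_pow_left₀ hy0 hyr 2
        _ = _ := by ring
    linarith [herr n hn1]

/-! ### From the load moment to the maximum load -/

open Classical in
lemma uniformSurjective_real_eq_expect (U ℓ : ℕ) (A : Set (HashMap U ℓ)) :
    (uniformSurjective U ℓ).real A = 𝔼 H : SurjHash U ℓ, if H.1 ∈ A then (1 : ℝ) else 0 := by
  have h1 : ∀ B : Set (HashMap U ℓ), (Measure.count B).toReal = B.ncard := fun B => by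
    rw [Measure.count_apply_finite' B.toFinite trivial, Set.ncard_eq_toFinset_card B B.toFinite]
    simp
  have h2 : (∑ H : SurjHash U ℓ, if H.1 ∈ A then (1 : ℝ) else 0) =
      ({H : HashMap U ℓ | Function.Surjective H} ∩ A).ncard := by
    rw [Finset.sum_boole, ← Set.ncard_coe_finset,
      ← Set.ncard_image_of_injective _ Subtype.val_injective]
    congr 2
    ext H
    simp [and_comm]
  rw [Measure.real, uniformSurjective, uniformOn, cond_apply (by trivial), ENNReal.toReal_mul,
    ENNReal.toReal_inv, h1, h1, Fintype.expect_eq_sum_div_card, h2, div_eq_inv_mul,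
    ← Nat.card_eq_fintype_card]
  rfl

/-- Only the fullest bin is kept in the average over `2 ^ ℓ` bins. -/
lemma mul_log_sub_le_log_loadMoment {U ℓ : ℕ} {c : ℝ} (hc : 1 ≤ c) (S : Finset (F2Vec U))
    (H : HashMap U ℓ) :
    maxLoad S H * Real.log c - ℓ * Real.log 2 ≤ Real.log (loadMoment c S H) := by
  obtain ⟨y, -, hy⟩ := Finset.exists_mem_eq_sup univ univ_nonempty (load S H)
  have hc0 : 0 < c := by linarith
  have hle : c ^ maxLoad S H / 2 ^ ℓ ≤ loadMoment c S H := by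
    rw [loadMoment, Fintype.expect_eq_sum_div_card, maxLoad, hy]
    have : (Fintype.card (F2Vec ℓ) : ℝ) = 2 ^ ℓ := by simp
    rw [this]
    gcongr
    exact Finset.single_le_sum (f := fun y => c ^ load S H y) (fun _ _ => by positivity)
      (mem_univ y)
  have h := Real.log_le_log (by positivity) hle
  rwa [Real.log_div (by positivity) (by positivity), Real.log_pow, Real.log_pow] at h

end LinearHashing

open LinearHashing BigOperators in
theorem proposition3p5 :
    ∃ C₀ D₀ : ℝ, 0 < C₀ ∧ 0 < D₀ ∧ ∃ ℓ₀ : ℕ,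
      ∀ (ℓ U : ℕ), ℓ₀ ≤ ℓ → ℓ ≤ U →
      ∀ S : Finset (LinearHashing.F2Vec U), S.card = 2 ^ ℓ →
      ∀ R : ℝ, 1 < R → D₀ * Real.log (ℓ : ℝ) ≤ R * (ℓ : ℝ) ^ (1 - 1 / R) →
        (LinearHashing.uniformSurjective U ℓ).real
            {H | R * ((ℓ : ℝ) / Real.logb 2 (ℓ : ℝ)) ≤ (LinearHashing.maxLoad S H : ℝ)} ≤
          C₀ * ((Real.log (ℓ : ℝ)) ^ 2 / (R ^ 2 * (ℓ : ℝ) ^ (2 - 2 / R))) := by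
  classical
  -- The 36 is the square of the 6 in `hratio`; 12 makes that ratio at most `1/2`, as the tail bound
  -- requires.
  refine ⟨864 * 36, 12, by norm_num, by norm_num, 2, ?_⟩
  intro ℓ U hℓ hU S hS R hR hD
  have hR0 : 0 < R := by linarith
  have hℓ1 : (1 : ℝ) < ℓ := by exact_mod_cast hℓ
  have hℓ0 : (0 : ℝ) < ℓ := by linarith
  have hlog : 0 < Real.log ℓ := Real.log_pos hℓ1
  have hlog2 : 1 / 2 < Real.log 2 := by linarith [Real.log_two_gt_d9]
  have he : Real.exp 1 < 3 := Real.exp_one_lt_three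
  have he2 : 2 ≤ Real.exp 1 := by linarith [Real.add_one_le_exp (1 : ℝ)]
  have hp1 : 1 ≤ (ℓ : ℝ) ^ (1 / R) := Real.one_le_rpow hℓ1.le (by positivity)
  have hsplit : (ℓ : ℝ) ^ (1 - 1 / R) * (ℓ : ℝ) ^ (1 / R) = ℓ := by
    rw [← Real.rpow_add hℓ0]; simp
  set p := (ℓ : ℝ) ^ (1 / R) with hp
  set q := (ℓ : ℝ) ^ (1 - 1 / R) with hq
  have hq0 : 0 < q := Real.rpow_pos_of_pos hℓ0 _
  have hqq : (ℓ : ℝ) ^ (2 - 2 / R) = q ^ 2 := by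
    rw [hq, ← Real.rpow_natCast, ← Real.rpow_mul hℓ0.le]
    congr 1
    push_cast
    ring
  -- With this base, `r * log c = r + ℓ * log 2`: after paying for the `2 ^ ℓ` bins, a load of `r`
  -- still forces `log Z ≥ r`.
  set c := Real.exp 1 * p with hc
  have hc2 : 2 ≤ c := by nlinarith
  have hlogc : Real.log c = 1 + Real.log ℓ / R := by
    rw [hc, Real.log_mul (by positivity) (by positivity), Real.log_exp, hp, Real.log_rpow hℓ0]
    ring
  set r := R * ℓ * Real.log 2 / Real.log ℓ with hr
  have hmean : meanTerm c S ℓ = c - 1 := by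
    rw [meanTerm, hS]; simp
  have hratio : meanTerm c S ℓ / r ≤ 6 * (Real.log ℓ / (R * q)) := by
    rw [hmean, show r = R * (q * p) * Real.log 2 / Real.log ℓ by rw [hsplit], div_div_eq_mul_div, mul_div_assoc',
      div_le_div_iff₀ (by positivity) (by positivity)]
    have h1 : (c - 1) ≤ 6 * (p * Real.log 2) := by nlinarith
    calc (c - 1) * Real.log ℓ * (R * q) ≤ 6 * (p * Real.log 2) * Real.log ℓ * (R * q) := by gcongr
      _ = _ := by ring
  have hr0 : 0 < r := by positivity
  have hxr : 2 * meanTerm c S ℓ ≤ r := by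
    have : Real.log ℓ / (R * q) ≤ 1 / 12 := by
      rw [div_le_div_iff₀ (by positivity) (by norm_num)]
      linarith
    have h2 : meanTerm c S ℓ / r ≤ 1 / 2 := by linarith
    rw [div_le_div_iff₀ hr0 two_pos] at h2
    linarith
  have hr1 : 1 ≤ r := by rw [hmean] at hxr; linarith
  rw [uniformSurjective_real_eq_expect]
  calc (𝔼 H : SurjHash U ℓ,
        if H.1 ∈ {H | R * ((ℓ : ℝ) / Real.logb 2 (ℓ : ℝ)) ≤ (maxLoad S H : ℝ)} then (1 : ℝ) else 0)
      ≤ 𝔼 H : SurjHash U ℓ, if r ≤ Real.log (loadMoment c S H.1) then (1 : ℝ) else 0 := by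
        refine Finset.expect_le_expect fun H _ => ?_
        by_cases hH : R * ((ℓ : ℝ) / Real.logb 2 (ℓ : ℝ)) ≤ (maxLoad S H.1 : ℝ)
        · have hle : r ≤ Real.log (loadMoment c S H.1) := by
            refine le_trans ?_ (mul_log_sub_le_log_loadMoment (by linarith) S H.1)
            have e : R * ((ℓ : ℝ) / Real.logb 2 (ℓ : ℝ)) = r := by
              rw [hr, Real.logb]; field_simp
            rw [e] at hH
            have h1 : r * Real.log c ≤ maxLoad S H.1 * Real.log c :=
              mul_le_mul_of_nonneg_right hH (Real.log_nonneg (by linarith))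
            have h2 : r * Real.log c = r + ℓ * Real.log 2 := by
              rw [hlogc, hr]; field_simp
            linarith
          simp [hH, hle]
        · simp only [Set.mem_ofPred_eq, hH, if_false]
          split_ifs <;> norm_num
    _ ≤ 864 * (meanTerm c S ℓ / r) ^ 2 :=
        expect_log_loadMoment_tail hU (by linarith) S hr1 hxr
    _ ≤ 864 * (6 * (Real.log ℓ / (R * q))) ^ 2 := by
        have h0 : 0 ≤ meanTerm c S ℓ / r :=
          div_nonneg (meanTerm_nonneg (by linarith) S ℓ) hr0.le
        gcongr
    _ = _ := by
        rw [hqq]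
        field_simp
        norm_num
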